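/- Boolean functions are taken on vectors of $n$ Boolean variables; for $x \in \{0,1\}^n$ write $|x| = \sum_i x_i 2^i$. A functional operation is a negation, a replacement of one variable by a constant, a binary synthesis $f \otimes g$, or a quantification over one variable. Permuting the arguments of a function of $k$ vectors counts as $3(k-1)n$ functional operations ($k = 8$ vectors are available), and constructing a multivariate threshold function, $f = 1 \Leftrightarrow \sum_j w_j |x^{(j)}| \ge T$ with $w_j \in \{-1,0,1\}$ and $T\in\mathbb{Z}$, counts as one. Let $G$ be a unit interval graph with nodes $v_0, \dots, v_{N-1}$, where $v_i$ stands for $[a_i, a_i+1]$, $a_0 \le \dots \le a_{N-1}$, and distinct nodes are adjacent iff their intervals intersect. Let $n = \lceil \log_2 N \rceil$ (with $n=0$ if $N = 0$). The implicit coloring algorithm receives $\chi_E(x,y)$ (which is $1$ iff $v_{|x|}$ and $v_{|y|}$ are nodes and adjacent) and $\chi_V(x)$ (which is $1$ iff $|x| < N$), and computes \begin{align*} E^c(x,y) &= \chi_V(x) \wedge \chi_V(y) \wedge \overline{\chi_E(x,y)} \wedge (|x| \ne |y|),\\ H_1(x,y,z) &= (|x| \le |z| < |y|) \wedge E^c(z,y),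 \qquad H_2(x,y,z) = (|x| < |z| \le |y|) \wedge E^c(x,z),\\ RE(x,y,l) &= (|x| \le |y|) \wedge \exists z: H_1(x,y,z) \wedge (|z|-|x| = |l|) \wedge \overline{\exists z': H_1(x,y,z') \wedge (|z'| > |z|)},\\ LE(x,y,l) &= (|x| \le |y|) \wedge \exists z: H_2(x,y,z) \wedge (|y|-|z| = |l|) \wedge \overline{\exists z': H_2(x,y,z') \wedge (|z'| < |z|)},\\ RELATED(x,y) &= \exists l: RE(x,y,l) \wedge LE(x,y,l) \wedge \overline{\exists z,l': (|z|<|y|) \wedge RE(x,z,l') \wedge LE(x,z,l')},\\ SAMECOLOR &= \text{TransitiveClosure}(RELATED(x,y) \vee (|x|=|y|)),\\ FIRST(x) &= \overline{\exists x': SAMECOLOR(x',x) \wedge (|x'|<|x|)},\\ COLORORDER(x,y) &= \exists x',y': SAMECOLOR(x',x) \wedge FIRST(x') \wedge SAMECOLOR(y',y) \wedge FIRST(y') \wedge (|x'| < |y'|),\\ COLOR(x,l) &= \text{EnumerateOrder}(COLORORDER(x,y)). \end{align*} Here TransitiveClosure$(R)$ replaces $R(x,y)$ by $\exists z: R(x,z)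 \wedge R(z,y)$, $n+1$ times in succession. EnumerateOrder$(O)$ computes $DS(x,y) = O(x,y) \wedge \overline{\exists z: O(x,z) \wedge O(z,y)}$ and $$EO_0(x,y,l) = \big((|l|=0) \wedge (|x|=|y|)\big) \vee \big((|l|=1) \wedge DS(x,y)\big);$$ then, for $i=1,\dots,n$, \begin{align*} EO_i(x,y,l) = {}& \big((|l| \le 2^{i-1}) \wedge EO_{i-1}(x,y,l)\big) \vee \Big[(2^{i-1} < |l| \le 2^i) \wedge {}\\ & \exists l',z: EO_{i-1}(x,z,[2^{i-1}]_2) \wedge EO_{i-1}(z,y,l') \wedge (|l'|+2^{i-1}=|l|)\Big], \end{align*} where $[m]_2$ is the binary number of value $m$; it returns $\exists z: EO_n(z,x,l) \wedge \overline{\exists z': O(z',z)}$. **Theorem.** For every such $G$, the output $COLOR$ is a coloring of $G$ with the minimum number of colors: there is a proper coloring $c$ of $G$ such that $COLOR(x,l) = 1 \Leftrightarrow |l| = c(v_{|x|})$ for all $x$ with $|x| < N$ and all $l$, and the set of colors used by $c$ is exactly $\{0, \dots, \chi(G)-1\}$, where $\chi(G)$ is the chromatic number. Moreover, the algorithm uses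 $O(\log^2 N)$ functional operations: there is an absolute constant $C$ such that for all $N \ge 2$ and all such $G$ on $N$ nodes it uses at most $C (\log_2 N)^2$ of them. -/

import Mathlib

namespace ImplicitColoring

/-- The names of the variable vectors `x, y, z, x', y', z', l, l'`, each of which holds `n` Boolean
variables. A function of fewer vectors simply ignores the others. -/
inductive Vec
  | x | y | z | x' | y' | z' | l | l'
  deriving DecidableEq

instance : Fintype Vec where
  elems := {.x, .y, .z, .x', .y', .z', .l, .l'}
  complete := by intro v; cases v <;> decide

/-- The value `|b| = ∑ i, b_i 2^i` of a binary number of length `n`. -/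
def val {n : ℕ} (b : Fin n → Bool) : ℕ := ∑ i, if b i then 2 ^ (i : ℕ) else 0

/-- An assignment of the Boolean variables of all vectors. -/
abbrev Assignment (n : ℕ) : Type := Vec → Fin n → Bool

/-- Boolean functions of the Boolean variables of all vectors. -/
abbrev BF (n : ℕ) : Type := Assignment n → Bool

/-- The assignment `a` with variable `i` of vector `v` replaced by the constant `c`. -/
def setBit {n : ℕ} (a : Assignment n) (v : Vec) (i : Fin n) (c : Bool) : Assignment n :=
  Function.update a v (Function.update (a v) i c)

/-- The two quantifiers. -/
inductive Quantifier
  | ex | all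

/-- One request to the package that manipulates Boolean functions. `H` is the type of handles to
Boolean functions: a program only sees handles and cannot look into the functions behind them.

`threshold w T` constructs the multivariate threshold function with weights `w` in `{-1, 0, 1}` and
threshold `T`. -/
inductive Op (n : ℕ) (H : Type) : Type
  | neg (f : H)
  | restrict (f : H) (v : Vec) (i : Fin n) (c : Bool)
  | synth (op : Bool → Bool → Bool) (f g : H)
  | quant (Q : Quantifier) (v : Vec) (i : Fin n) (f : H)
  | reorder (ρ : Equiv.Perm Vec) (f : H)
  | threshold (w : Vec → SignType) (T : ℤ)

/-- The Boolean function that a request computes. -/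
def Op.eval {n : ℕ} : Op n (BF n) → BF n
  | .neg f => fun a => !f a
  | .restrict f v i c => fun a => f (setBit a v i c)
  | .synth op f g => fun a => op (f a) (g a)
  | .quant .ex v i f => fun a => f (setBit a v i false) || f (setBit a v i true)
  | .quant .all v i f => fun a => f (setBit a v i false) && f (setBit a v i true)
  | .reorder ρ f => fun a => f (fun v => a (ρ v))
  | .threshold w T => fun a => decide (T ≤ ∑ v, (w v : ℤ) * (val (a v) : ℤ))

/-- The number of functional operations that a request is charged with. Negation, replacement of
one variable by a constant, binary synthesis, and quantification over one variable are single
functional operations; an argument reordering of `k` vectors of length `n` amounts to `3 (k - 1) n`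
of them. The construction of a threshold function is charged as one functional operation. -/
def Op.cost {n : ℕ} {H : Type} : Op n H → ℕ
  | .reorder _ _ => 3 * (Fintype.card Vec - 1) * n
  | _ => 1

/-- Implicit programs: they issue requests one after another, and finally return a value. -/
inductive Prog (n : ℕ) (H α : Type) : Type
  | done (a : α) : Prog n H α
  | step (o : Op n H) (k : H → Prog n H α) : Prog n H α

namespace Prog

variable {n : ℕ} {H α β : Type}

/-- Sequential composition. -/
def andThen : Prog n H α → (α → Prog n H β) → Prog n H β
  | done a, g => g a
  | step o k, g => step o fun h => (k h).andThen g

instance : Monad (Prog n H) where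
  pure := done
  bind := andThen

/-- The value that a program returns when it is run on Boolean functions. -/
def result : Prog n (BF n) α → α
  | done a => a
  | step o k => (k o.eval).result

/-- The number of functional operations that a program uses when it is run on Boolean functions. -/
def ops : Prog n (BF n) α → ℕ
  | done _ => 0
  | step o k => o.cost + (k o.eval).ops

end Prog

section Routines

variable {n : ℕ} {H : Type}

/-- Issue one request and return the handle of the function computed. -/
def call (o : Op n H) : Prog n H H := .step o .done

/-- Negation. -/
def pNot (f : H) : Prog n H H := call (.neg f)

/-- Conjunction. -/
def pAnd (f g : H) : Prog n H H := call (.synth and f g)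

/-- Disjunction. -/
def pOr (f g : H) : Prog n H H := call (.synth or f g)

/-- Argument reordering. -/
def pReorder (ρ : Equiv.Perm Vec) (f : H) : Prog n H H := call (.reorder ρ f)

/-- Existential quantification over the vector `v`, one variable after the other. -/
def pExists (v : Vec) (f : H) : Prog n H H :=
  (List.finRange n).foldlM (fun g i => call (.quant .ex v i g)) f

/-- Replacement of the vector `v` by the binary number `[m]_2`, one variable after the other. -/
def pConst (v : Vec) (m : ℕ) (f : H) : Prog n H H :=
  (List.finRange n).foldlM (fun g i => call (.restrict g v i (m.testBit i))) f

/-- The weight vector of `∑ v ∈ p, |v| - ∑ v ∈ q, |v|` for disjoint lists `p` and `q`. -/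
def weights (p q : List Vec) (v : Vec) : SignType :=
  if v ∈ p then 1 else if v ∈ q then -1 else 0

/-- `∑ v ∈ p, |v| ≥ ∑ v ∈ q, |v| + T`. -/
def pGe (p q : List Vec) (T : ℤ) : Prog n H H := call (.threshold (weights p q) T)

/-- `∑ v ∈ p, |v| = ∑ v ∈ q, |v| + T`. -/
def pEq (p q : List Vec) (T : ℤ) : Prog n H H := do
  pAnd (← pGe p q T) (← pGe q p (-T))

/-- `|u| ≤ |v|`. -/
def pLe (u v : Vec) : Prog n H H := pGe [v] [u] 0

/-- `|u| < |v|`. -/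
def pLt (u v : Vec) : Prog n H H := pGe [v] [u] 1

/-- For `u ≠ v` the permutation that turns `f(x, y)` into `f(u, v)`. -/
def args (u v : Vec) : Equiv.Perm Vec :=
  Equiv.swap .x u * Equiv.swap .y (Equiv.swap .x u v)

theorem args_spec : ∀ u v : Vec, u ≠ v → args u v .x = u ∧ args u v .y = v := by
  decide

/-- The transitive closure of a relation `R(x, y)` by iterative squaring. -/
def transitiveClosure (R : H) : Prog n H H :=
  (List.range (n + 1)).foldlM (fun S _ => do
    pExists .z (← pAnd (← pReorder (args .x .z) S) (← pReorder (args .z .y) S))) R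

/-- The initial function `EO_0(x, y, l)`, computed from the direct successor relation. -/
def enumStart (DS : H) : Prog n H H := do
  let same ← pAnd (← pEq [.l] [] 0) (← pEq [.x] [.y] 0)
  let next ← pAnd (← pEq [.l] [] 1) DS
  pOr same next

/-- The function `EO_{j+1}(x, y, l)`, computed from `EO = EO_j`. -/
def enumStep (EO : H) (j : ℕ) : Prog n H H := do
  -- `|l| ≤ 2^j`
  let small ← pAnd (← pGe [] [.l] (-2 ^ j)) EO
  -- `2^j < |l| ≤ 2^(j+1)`
  let large ← pAnd (← pGe [.l] [] (2 ^ j + 1)) (← pGe [] [.l] (-2 ^ (j + 1)))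
  -- `EO_j(x, z, 2^j)`
  let left ← pReorder (args .x .z) (← pConst .l (2 ^ j) EO)
  -- `EO_j(z, y, l')`
  let right ← pReorder (args .z .y * Equiv.swap .l .l') EO
  -- `|l'| + 2^j = |l|`
  let sum ← pEq [.l] [.l'] (2 ^ j)
  let mid ← pExists .l' (← pExists .z (← pAnd (← pAnd left right) sum))
  pOr small (← pAnd large mid)

/-- The ranks `EO(x, l)` of an order `O(x, y)`: `|l|` is the rank of `x`. -/
def enumerateOrder (O : H) : Prog n H H := do
  let between ← pExists .z
    (← pAnd (← pReorder (args .x .z) O) (← pReorder (args .z .y) O))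
  let DS ← pAnd O (← pNot between)
  let EO ← (List.range n).foldlM enumStep (← enumStart DS)
  -- `EO_n(z, x, l)`
  let EOzx ← pReorder (args .z .x) EO
  -- `∃ z', O(z', z)`
  let pred ← pExists .z' (← pReorder (args .z' .z) O)
  pExists .z (← pAnd EOzx (← pNot pred))

/-- `χ_{E^c}(x, y)`, the edges of the complement graph. -/
def complementEdges (χE χV : H) : Prog n H H := do
  let nodes ← pAnd χV (← pReorder (Equiv.swap .x .y) χV)
  pAnd (← pAnd nodes (← pNot χE)) (← pNot (← pEq [.x] [.y] 0))

/-- `RE(x, y, l)`: the number of right endpoints between `b_|x|` and `a_|y|` is `|l|`. -/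
def rightEndpoints (Ec : H) : Prog n H H := do
  -- `H₁(x, y, z)`
  let H₁ ← pAnd (← pAnd (← pLe .x .z) (← pLt .z .y)) (← pReorder (args .z .y) Ec)
  let larger ← pExists .z'
    (← pAnd (← pReorder (Equiv.swap .z .z') H₁) (← pLt .z .z'))
  -- `|z| - |x| = |l|`
  let diff ← pEq [.z] [.x, .l] 0
  let body ← pExists .z (← pAnd (← pAnd H₁ diff) (← pNot larger))
  pAnd (← pLe .x .y) body

/-- `LE(x, y, l)`: the number of left endpoints between `b_|x|` and `a_|y|` is `|l|`. -/
def leftEndpoints (Ec : H) : Prog n H H := do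
  -- `H₂(x, y, z)`
  let H₂ ← pAnd (← pAnd (← pLt .x .z) (← pLe .z .y)) (← pReorder (args .x .z) Ec)
  let smaller ← pExists .z'
    (← pAnd (← pReorder (Equiv.swap .z .z') H₂) (← pLt .z' .z))
  -- `|y| - |z| = |l|`
  let diff ← pEq [.y] [.z, .l] 0
  let body ← pExists .z (← pAnd (← pAnd H₂ diff) (← pNot smaller))
  pAnd (← pLe .x .y) body

/-- `RELATED(x, y)`, computed from `RE` and `LE`. -/
def related (RE LE : H) : Prog n H H := do
  let here ← pAnd RE LE
  -- `∃ z l', |z| < |y| ∧ RE(x, z, l') ∧ LE(x, z, l')`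
  let ρ := args .x .z * Equiv.swap .l .l'
  let there ← pAnd (← pReorder ρ RE) (← pReorder ρ LE)
  let earlier ← pExists .l' (← pExists .z (← pAnd (← pLt .z .y) there))
  pExists .l (← pAnd here (← pNot earlier))

/-- `FIRST(x)`: no smaller element reaches `x` along the relation `SAMECOLOR`. -/
def firstElements (SC : H) : Prog n H H := do
  pNot (← pExists .x' (← pAnd (← pReorder (args .x' .x) SC) (← pLt .x' .x)))

/-- `COLORORDER(x, y)`: the classes are ordered by their first elements. -/
def colorOrder (SC FIRST : H) : Prog n H H := do
  let cx ← pAnd (← pReorder (args .x' .x) SC) (← pReorder (Equiv.swap .x .x') FIRST)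
  let cy ← pAnd (← pReorder (args .y' .y) SC) (← pReorder (Equiv.swap .x .y') FIRST)
  pExists .y' (← pExists .x' (← pAnd (← pAnd cx cy) (← pLt .x' .y')))

/-- The implicit coloring algorithm for unit interval graphs. The inputs are (handles to) the
characteristic functions `χ_E(x, y)` and `χ_V(x)`, the output is `COLOR(x, l)`. -/
def unitColoring (χE χV : H) : Prog n H H := do
  let Ec ← complementEdges χE χV
  let RE ← rightEndpoints Ec
  let LE ← leftEndpoints Ec
  let RELATED ← related RE LE
  let SAMECOLOR ← transitiveClosure (← pOr RELATED (← pEq [.x] [.y] 0))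
  let FIRST ← firstElements SAMECOLOR
  let COLORORDER ← colorOrder SAMECOLOR FIRST
  enumerateOrder COLORORDER

end Routines

/-- `G` is the graph of the unit intervals `[a_i, a_i + 1]`, and its nodes are labeled in the order
of the left endpoints. -/
def IsUnitIntervalGraph {N : ℕ} (G : SimpleGraph (Fin N)) : Prop :=
  ∃ a : Fin N → ℝ, Monotone a ∧ ∀ i j, G.Adj i j ↔
    i ≠ j ∧ (Set.Icc (a i) (a i + 1) ∩ Set.Icc (a j) (a j + 1)).Nonempty

/-- The number of bits `⌈log₂ N⌉` of a node. -/
abbrev bits (N : ℕ) : ℕ := Nat.clog 2 N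

open Classical in
/-- The characteristic function `χ_E(x, y)` of the edge set. -/
noncomputable def chiE {N : ℕ} (G : SimpleGraph (Fin N)) : BF (bits N) := fun a =>
  decide (∃ i j : Fin N, val (a .x) = i ∧ val (a .y) = j ∧ G.Adj i j)

/-- The characteristic function `χ_V(x)` of the node set. -/
def chiV (N : ℕ) : BF (bits N) := fun a => decide (val (a .x) < N)

/-- The run of the implicit coloring algorithm on `G`. -/
noncomputable def coloringRun {N : ℕ} (G : SimpleGraph (Fin N)) :
    Prog (bits N) (BF (bits N)) (BF (bits N)) :=
  unitColoring (chiE G) (chiV N)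

end ImplicitColoring

/-! Read the endpoints from left to right, a right endpoint as an opening bracket and a left
endpoint as a closing one: an interval that has ended offers its color to a later one. `Matched`
pairs the brackets. It is injective in both directions and goes strictly rightwards, so its chains
partition the nodes. Members of one chain are pairwise nonadjacent, so coloring chains, numbered by
their first nodes, is proper.

For optimality, the depth `y - g y` is the number of earlier nodes adjacent to `y`; together with
`y` they form a clique. A left endpoint without a match is a strict record of the depth
(`exists_matched`), so the first node of chain number `j` has depth at least `j` (`rank_le_depth`).
The last chain thus yields a clique with as many nodes as there are colors
(`exists_minimum_coloring`).

On the program side, `Spec` turns every computed function into a predicate on the numbers held by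
the vectors. Iterated squaring reaches whole chains because chains increase, and doubling recovers
ranks because ranks have no gaps. Control flow does not depend on the functions, so the cost is an
exact polynomial in `n`. -/

namespace ImplicitColoring

/-! ### Binary numbers and sums over the vectors -/

section Binary

variable {n : ℕ}

theorem val_eq_ofBits (b : Fin n → Bool) : val b = Nat.ofBits b := by
  induction n with
  | zero => simp [val, Nat.ofBits]
  | succ n ih =>
    rw [Nat.ofBits_succ, ← ih, val, Fin.sum_univ_succ, val, Finset.mul_sum]
    simp only [Fin.val_zero, pow_zero, Fin.val_succ, Function.comp, pow_succ']
    rw [add_comm]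
    congr 1
    · exact Finset.sum_congr rfl fun i _ => by split_ifs <;> simp
    · cases b 0 <;> rfl

theorem val_lt (b : Fin n → Bool) : val b < 2 ^ n := by
  rw [val_eq_ofBits]; exact Nat.ofBits_lt_two_pow b

theorem val_testBit {m : ℕ} (hm : m < 2 ^ n) : val (fun i : Fin n => m.testBit i) = m := by
  rw [val_eq_ofBits, Nat.ofBits_testBit, Nat.mod_eq_of_lt hm]

theorem exists_val (P : ℕ → Prop) : (∃ b : Fin n → Bool, P (val b)) ↔ ∃ m < 2 ^ n, P m :=
  ⟨fun ⟨b, h⟩ => ⟨_, val_lt b, h⟩, fun ⟨m, hm, h⟩ => ⟨fun i => m.testBit i, by rwa [val_testBit hm]⟩⟩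

theorem Vec.sum_univ {M : Type*} [AddCommMonoid M] (F : Vec → M) :
    ∑ v, F v = F .x + (F .y + (F .z + (F .x' + (F .y' + (F .z' + (F .l + F .l')))))) := by
  have h : (Finset.univ : Finset Vec) = {.x, .y, .z, .x', .y', .z', .l, .l'} := rfl
  simp [h]

end Binary

/-! ### Results and costs of composed programs -/

namespace Prog

variable {n : ℕ} {α β : Type}

theorem result_bind (p : Prog n (BF n) α) (g : α → Prog n (BF n) β) :
    (p >>= g).result = (g p.result).result := by
  induction p with
  | done a => rfl
  | step o k ih => exact ih o.eval

theorem ops_bind (p : Prog n (BF n) α) (g : α → Prog n (BF n) β) :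
    (p >>= g).ops = p.ops + (g p.result).ops := by
  induction p with
  | done a => exact (Nat.zero_add _).symm
  | step o k ih => exact (congrArg (o.cost + ·) (ih o.eval)).trans (Nat.add_assoc _ _ _).symm

theorem result_foldlM (g : α → β → Prog n (BF n) α) (L : List β) (s : α) :
    (L.foldlM g s).result = L.foldl (fun t i => (g t i).result) s := by
  induction L generalizing s with
  | nil => rfl
  | cons i L ih => rw [List.foldlM_cons, result_bind, ih, List.foldl_cons]

theorem ops_foldlM (g : α → β → Prog n (BF n) α) (L : List β) (s : α) {k : ℕ}
    (h : ∀ t i, (g t i).ops = k) : (L.foldlM g s).ops = L.length * k := by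
  induction L generalizing s with
  | nil => exact (Nat.zero_mul _).symm
  | cons i L ih => rw [List.foldlM_cons, ops_bind, ih, h, List.length_cons]; ring

end Prog

/-! ### Boolean functions as predicates on numbers -/

section Spec

variable {n : ℕ}

/-- The Boolean function `f` is the characteristic function of the property `P` of the values of
the vectors. -/
def Spec (f : BF n) (P : (Vec → ℕ) → Prop) : Prop :=
  ∀ a, f a = true ↔ P fun v => val (a v)

variable {f g : BF n} {P Q : (Vec → ℕ) → Prop}

/-- The available bound `e v < 2 ^ n` is what lets later proofs trade quantifiers over `n`-bit
numbers for unbounded ones. -/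
theorem Spec.congr (hf : Spec f P) (h : ∀ e, (∀ v, e v < 2 ^ n) → (P e ↔ Q e)) : Spec f Q :=
  fun a => (hf a).trans (h _ fun v => val_lt (a v))

theorem spec_pNot (hf : Spec f P) : Spec (pNot f).result fun e => ¬P e := fun a => by
  exact (Bool.not_eq_true' (f a)).to_iff.trans ((Bool.not_eq_true (f a)).symm.to_iff.trans (hf a).not)

theorem spec_pAnd (hf : Spec f P) (hg : Spec g Q) :
    Spec (pAnd f g).result fun e => P e ∧ Q e := fun a => by
  exact Bool.and_eq_true_iff.trans (and_congr (hf a) (hg a))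

theorem spec_pOr (hf : Spec f P) (hg : Spec g Q) :
    Spec (pOr f g).result fun e => P e ∨ Q e := fun a => by
  exact Bool.or_eq_true_iff.trans (or_congr (hf a) (hg a))

theorem spec_pReorder (ρ : Equiv.Perm Vec) (hf : Spec f P) :
    Spec (pReorder ρ f).result fun e => P fun v => e (ρ v) := fun a => hf fun v => a (ρ v)

theorem setBit_update (a : Assignment n) (v : Vec) (b : Fin n → Bool) (i : Fin n) (c : Bool) :
    setBit (Function.update a v b) v i c = Function.update a v (Function.update b i c) := by
  simp [setBit]

theorem val_update (a : Assignment n) (v : Vec) (b : Fin n → Bool) :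
    (fun w => val (Function.update a v b w)) =
      Function.update (fun w => val (a w)) v (val b) := by
  funext w
  rcases eq_or_ne w v with rfl | h <;> simp [*]

/-- Only the bits listed in `L` have been quantified, so the witness `b` must agree with `a v`
elsewhere; for the full list it is arbitrary. -/
theorem foldlM_quant_ex (v : Vec) (L : List (Fin n)) (f : BF n) (a : Assignment n) :
    (L.foldlM (fun g i => call (.quant .ex v i g)) f : Prog n (BF n) (BF n)).result a = true ↔
      ∃ b : Fin n → Bool, (∀ i ∉ L, b i = a v i) ∧ f (Function.update a v b) = true := by
  induction L generalizing f with
  | nil =>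
    change f a = true ↔ _
    constructor
    · intro h
      exact ⟨a v, fun _ _ => rfl, by simpa using h⟩
    · rintro ⟨b, hb, h⟩
      obtain rfl : b = a v := funext fun i => hb i (by simp)
      simpa using h
  | cons i L ih =>
    rw [List.foldlM_cons, Prog.result_bind, ih]
    have key : ∀ a', (call (.quant .ex v i f) : Prog n (BF n) (BF n)).result a' = true ↔
        ∃ c, f (setBit a' v i c) = true := fun a' => by
      rw [Bool.exists_bool]; exact Bool.or_eq_true_iff
    simp only [key, setBit_update]
    constructor
    · rintro ⟨b, hb, c, h⟩
      refine ⟨_, fun j hj => ?_, h⟩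
      rw [List.mem_cons, not_or] at hj
      rw [Function.update_of_ne hj.1, hb j hj.2]
    · rintro ⟨b, hb, h⟩
      -- Bit `i` is reset so that the induction hypothesis applies to `L`; the quantifier over bit
      -- `i` then puts `b i` back.
      refine ⟨Function.update b i (a v i), fun j hj => ?_, b i, by simpa using h⟩
      rcases eq_or_ne j i with rfl | hji
      · simp
      · rw [Function.update_of_ne hji, hb j (by simp [hji, hj])]

theorem spec_pExists (v : Vec) (hf : Spec f P) :
    Spec (pExists v f).result fun e => ∃ m < 2 ^ n, P (Function.update e v m) := fun a => by
  refine Iff.trans ?_ (exists_val fun m => P (Function.update (fun w => val (a w)) v m))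
  rw [pExists, foldlM_quant_ex]
  simp [hf _, val_update]

theorem foldlM_restrict (v : Vec) (m : ℕ) (L : List (Fin n)) (f : BF n) (a : Assignment n) :
    (L.foldlM (fun g i => call (.restrict g v i (m.testBit i))) f :
        Prog n (BF n) (BF n)).result a =
      f (Function.update a v fun i => if i ∈ L then m.testBit i else a v i) := by
  induction L generalizing f with
  | nil => simp; rfl
  | cons i L ih =>
    rw [List.foldlM_cons, Prog.result_bind, ih]
    refine (congrArg f (setBit_update a v _ i _)).trans ?_
    congr 2
    funext j
    rcases eq_or_ne j i with rfl | hji <;> simp [*]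

theorem spec_pConst (v : Vec) {m : ℕ} (hm : m < 2 ^ n) (hf : Spec f P) :
    Spec (pConst v m f).result fun e => P (Function.update e v m) := fun a => by
  rw [pConst, foldlM_restrict, hf, val_update]
  simp [val_testBit hm]

theorem spec_pGe (p q : List Vec) (T : ℤ) :
    Spec (pGe p q T : Prog n (BF n) (BF n)).result
      fun e => T ≤ ∑ v, (weights p q v : ℤ) * (e v : ℤ) := fun _ => decide_eq_true_iff

theorem spec_pEq (p q : List Vec) (T : ℤ) :
    Spec (pEq p q T : Prog n (BF n) (BF n)).result fun e =>
      T ≤ ∑ v, (weights p q v : ℤ) * (e v : ℤ) ∧ -T ≤ ∑ v, (weights q p v : ℤ) * (e v : ℤ) :=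
  spec_pAnd (spec_pGe p q T) (spec_pGe q p (-T))

theorem spec_pLe {u v : Vec} (h : u ≠ v) :
    Spec (pLe u v : Prog n (BF n) (BF n)).result fun e => e u ≤ e v :=
  (spec_pGe _ _ _).congr fun e _ => by
    revert h
    cases u <;> cases v <;> intro h <;> first | exact absurd rfl h | simp [weights, Vec.sum_univ]

/-- Distinctness matters: in `weights` the first list takes precedence, so `u = v` would express `1
≤ e v`. -/
theorem spec_pLt {u v : Vec} (h : u ≠ v) :
    Spec (pLt u v : Prog n (BF n) (BF n)).result fun e => e u < e v :=
  (spec_pGe _ _ _).congr fun e _ => by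
    revert h
    cases u <;> cases v <;> intro h <;>
      first | exact absurd rfl h | (simp [weights, Vec.sum_univ] <;> omega)

theorem spec_xEqY : Spec (pEq [.x] [.y] 0 : Prog n (BF n) (BF n)).result fun e => e .x = e .y :=
  (spec_pEq _ _ _).congr fun e _ => by simp [weights, Vec.sum_univ]; omega

end Spec

/-! ### Bracket matching of right and left endpoints -/

section Matching

variable {N : ℕ} {f g : ℕ → ℕ}

/-- `f x` is the first node to the right of node `x` that is not adjacent to it (`N` if there is
none), and the nodes to the left of node `y` that are not adjacent to it are those below `g y`. -/
structure EndpointOrder (N : ℕ) (f g : ℕ → ℕ) : Prop where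
  lt_first : ∀ x, x < N → x < f x
  count_le : ∀ y, y < N → g y ≤ y
  lt_iff : ∀ x y, x < N → y < N → (x < g y ↔ f x ≤ y)
  mono : ∀ y z, y ≤ z → z < N → g y ≤ g z

/-- The numbers of right endpoints and of left endpoints between the right endpoint of `x` and the
left endpoint of `y` coincide. -/
def Balanced (N : ℕ) (f g : ℕ → ℕ) (x y : ℕ) : Prop :=
  x < N ∧ y < N ∧ f x ≤ y ∧ y + x + 1 = f x + g y

/-- The right endpoint of `x` and the left endpoint of `y` are matching brackets. -/
def Matched (N : ℕ) (f g : ℕ → ℕ) (x y : ℕ) : Prop :=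
  Balanced N f g x y ∧ ∀ z < y, ¬Balanced N f g x z

theorem Matched.right_unique {x y z : ℕ} (h : Matched N f g x y) (h' : Matched N f g x z) :
    y = z := by
  rcases lt_trichotomy y z with hlt | rfl | hlt
  · exact absurd h.1 (h'.2 _ hlt)
  · rfl
  · exact absurd h'.1 (h.2 _ hlt)

theorem Matched.lt (hfg : EndpointOrder N f g) {x y : ℕ} (h : Matched N f g x y) : x < y :=
  (hfg.lt_first x h.1.1).trans_le h.1.2.2.1

/-- The depth `y - g y` increases by at most one in each step, so that it takes all values in
between. -/
theorem EndpointOrder.exists_depth_eq (hfg : EndpointOrder N f g) {d s t : ℕ} (hst : s ≤ t)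
    (ht : t < N) (hs : s ≤ d + g s) (hd : d + g t ≤ t) : ∃ y, s ≤ y ∧ y ≤ t ∧ y = d + g y := by
  induction t, hst using Nat.le_induction with
  | base => exact ⟨s, le_rfl, le_rfl, by omega⟩
  | succ t hst ih =>
    by_cases h : d + g t ≤ t
    · obtain ⟨y, h₁, h₂, h₃⟩ := ih (by omega) h
      exact ⟨y, h₁, by omega, h₃⟩
    · have := hfg.mono t (t + 1) (by omega) ht
      exact ⟨t + 1, by omega, le_rfl, by omega⟩

/-- Balance with `x` means that the depth of `y` equals `d = f x - x - 1`, and likewise for `x'`. If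
`x < x'`, the depth is at most `d` at `f x` and at least `d` at `f x' - 1`, so it equals `d`
somewhere in between. That node precedes `y` and is balanced with `x`, against the minimality of
`y`. -/
theorem Matched.not_lt_of_right_eq (hfg : EndpointOrder N f g) {x x' y : ℕ} (h : Matched N f g x y)
    (h' : Matched N f g x' y) : ¬x < x' := fun hlt => by
  obtain ⟨⟨hx, hy, hxy, he⟩, hmin⟩ := h
  obtain ⟨⟨hx', -, hxy', he'⟩, -⟩ := h'
  have hfx := hfg.lt_first x' hx'
  have hgy := hfg.count_le y hy
  have h₁ := hfg.lt_iff x (f x) hx (by omega)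
  have h₂ := hfg.lt_iff x' (f x' - 1) hx' (by omega)
  obtain ⟨z, hz₁, hz₂, hz₃⟩ := hfg.exists_depth_eq (d := y - g y) (s := f x) (t := f x' - 1)
    (by omega) (by omega) (by omega) (by omega)
  exact hmin z (by omega) ⟨hx, by omega, hz₁, by omega⟩

theorem Matched.left_unique (hfg : EndpointOrder N f g) {x w y : ℕ} (hx : Matched N f g x y)
    (hw : Matched N f g w y) : x = w :=
  le_antisymm (not_lt.1 (hw.not_lt_of_right_eq hfg hx)) (not_lt.1 (hx.not_lt_of_right_eq hfg hw))

/-- A left endpoint at which the depth is not a strict record has a match. -/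
theorem EndpointOrder.exists_matched (hfg : EndpointOrder N f g) {y y' : ℕ} (hy : y < N)
    (hlt : y' < y) (hle : y - g y ≤ y' - g y') : ∃ x, Matched N f g x y := by
  classical
  -- The last node `t` before `y` whose depth is at least that of `y`.
  let p : ℕ → Prop := fun t => t < y ∧ y - g y ≤ t - g t
  obtain ⟨hty, htd⟩ : p (Nat.findGreatest p y) := Nat.findGreatest_spec (P := p) hlt.le ⟨hlt, hle⟩
  have hmax : ∀ z, Nat.findGreatest p y < z → z < y → z - g z < y - g y := fun z h₁ h₂ => by
    have := Nat.findGreatest_is_greatest h₁ h₂.le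
    simp only [p] at this
    omega
  generalize Nat.findGreatest p y = t at hty htd hmax
  have hgt := hfg.count_le t (by omega)
  have hgy := hfg.count_le y hy
  have hgs := hfg.count_le (t + 1) (by omega)
  have hstep : t + 1 - g (t + 1) ≤ y - g y := by
    rcases eq_or_lt_of_le (Nat.succ_le_of_lt hty) with h | h
    · rw [← h]
    · exact (hmax (t + 1) (by omega) h).le
  have h₁ := hfg.lt_iff (t - (y - g y)) t (by omega) (by omega)
  have h₂ := hfg.lt_iff (t - (y - g y)) (t + 1) (by omega) (by omega)
  -- With `d` the depth of `y`, the depths at `t` and `t + 1` give `g t ≤ t - d < g (t + 1)`, that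
  -- is, `f (t - d) = t + 1`. An earlier balanced `z` would lie after `t` and have depth `d`, which
  -- the choice of `t` excludes.
  refine ⟨t - (y - g y), ⟨by omega, hy, by omega, by omega⟩, fun z hz ⟨_, _, hfz, he⟩ => ?_⟩
  have := hmax z (by omega) hz
  have := hfg.count_le z (by omega)
  omega

/-- `x` is the leftmost node of its color class. -/
def IsFirst (N : ℕ) (f g : ℕ → ℕ) (x : ℕ) : Prop := ∀ w, ¬Matched N f g w x

theorem isFirst_of_le {x : ℕ} (h : N ≤ x) : IsFirst N f g x := fun _ hw =>
  absurd hw.1.2.1 (not_lt.2 h)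

/-- Numbers from `N` on are singleton classes, as they are for the algorithm. Being infinitely many,
they keep `Nat.nth` away from its default value. -/
theorem setOf_isFirst_infinite : {x | IsFirst N f g x}.Infinite :=
  (Set.Ici_infinite N).mono fun _ => isFirst_of_le

/-! ### Chains of matches, their first nodes and their ranks -/

open Relation

theorem EndpointOrder.le_of_chain (hfg : EndpointOrder N f g) {x y : ℕ}
    (h : ReflTransGen (Matched N f g) x y) : x ≤ y := by
  induction h with
  | refl => exact le_rfl
  | tail _ h ih => exact ih.trans (h.lt hfg).le

theorem EndpointOrder.exists_first (hfg : EndpointOrder N f g) (x : ℕ) :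
    ∃ r, ReflTransGen (Matched N f g) r x ∧ IsFirst N f g r := by
  induction x using Nat.strong_induction_on with
  | _ x ih =>
    by_cases h : IsFirst N f g x
    · exact ⟨x, .refl, h⟩
    · obtain ⟨w, hw⟩ := not_forall_not.1 h
      obtain ⟨r, hr, hr'⟩ := ih w (hw.lt hfg)
      exact ⟨r, hr.tail hw, hr'⟩

/-- By `left_unique` the way back along matches is forced. -/
theorem EndpointOrder.first_unique (hfg : EndpointOrder N f g) {x r r' : ℕ}
    (hr : ReflTransGen (Matched N f g) r x) (hf : IsFirst N f g r)
    (hr' : ReflTransGen (Matched N f g) r' x) (hf' : IsFirst N f g r') : r = r' := by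
  induction hr with
  | refl =>
    rcases hr'.cases_tail with h | ⟨w, -, h⟩
    · exact h
    · exact absurd h (hf w)
  | tail _ h ih =>
    rcases hr'.cases_tail with h' | ⟨w, hw, h'⟩
    · exact absurd (h' ▸ h) (hf' _)
    · exact ih (h.left_unique hfg h' ▸ hw)

open Classical in
/-- The leftmost node of the color class of `x`. -/
noncomputable def firstOf (N : ℕ) (f g : ℕ → ℕ) (x : ℕ) : ℕ :=
  if h : ∃ r, ReflTransGen (Matched N f g) r x ∧ IsFirst N f g r then h.choose else x

theorem EndpointOrder.firstOf_spec (hfg : EndpointOrder N f g) (x : ℕ) :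
    ReflTransGen (Matched N f g) (firstOf N f g x) x ∧ IsFirst N f g (firstOf N f g x) := by
  rw [firstOf, dif_pos (hfg.exists_first x)]
  exact (hfg.exists_first x).choose_spec

theorem EndpointOrder.firstOf_eq_iff (hfg : EndpointOrder N f g) {x r : ℕ} :
    firstOf N f g x = r ↔ ReflTransGen (Matched N f g) r x ∧ IsFirst N f g r := by
  constructor
  · rintro rfl
    exact hfg.firstOf_spec x
  · intro h
    exact hfg.first_unique (hfg.firstOf_spec x).1 (hfg.firstOf_spec x).2 h.1 h.2

theorem EndpointOrder.firstOf_le (hfg : EndpointOrder N f g) (x : ℕ) : firstOf N f g x ≤ x :=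
  hfg.le_of_chain (hfg.firstOf_spec x).1

theorem EndpointOrder.isFirst_iff (hfg : EndpointOrder N f g) {x : ℕ} :
    IsFirst N f g x ↔ ¬∃ w, ReflTransGen (Matched N f g) w x ∧ w < x := by
  constructor
  · rintro h ⟨w, hw, hlt⟩
    rcases hw.cases_tail with rfl | ⟨v, -, hv⟩
    · exact lt_irrefl _ hlt
    · exact h v hv
  · exact fun h w hw => h ⟨w, .single hw, hw.lt hfg⟩

/-- Distinct elements of one chain are not adjacent. -/
theorem EndpointOrder.first_le_of_firstOf_eq (hfg : EndpointOrder N f g) {x y : ℕ} (hxy : x < y)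
    (h : firstOf N f g x = firstOf N f g y) : f x ≤ y := by
  have hx := (hfg.firstOf_spec x).1
  have hy := (hfg.firstOf_spec y).1
  rw [← h] at hy
  -- Each node has at most one match to its right, so two nodes reached from the same first node are
  -- comparable.
  have hch : ReflTransGen (Matched N f g) x y := by
    rcases ReflTransGen.total_of_right_unique (fun _ _ _ h h' => h.right_unique h') hx hy with h | h
    · exact h
    · exact absurd (hfg.le_of_chain h) (not_le.2 hxy)
  rcases hch.cases_head with rfl | ⟨w, hw, hwy⟩
  · exact absurd hxy (lt_irrefl _)
  · exact hw.1.2.2.1.trans (hfg.le_of_chain hwy)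

open Classical in
/-- The color of `x`: the number of color classes that start before the one of `x`. -/
noncomputable def rank (N : ℕ) (f g : ℕ → ℕ) (x : ℕ) : ℕ :=
  Nat.count (IsFirst N f g) (firstOf N f g x)

theorem EndpointOrder.rank_lt_iff (hfg : EndpointOrder N f g) {x y : ℕ} :
    rank N f g x < rank N f g y ↔ firstOf N f g x < firstOf N f g y := by
  classical
  constructor
  · intro h
    by_contra hle
    exact absurd (Nat.count_monotone (IsFirst N f g) (not_lt.1 hle)) (not_le.2 (by simpa [rank] using h))
  · exact Nat.count_strict_mono (hfg.firstOf_spec x).2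

theorem EndpointOrder.rank_eq_iff (hfg : EndpointOrder N f g) {x y : ℕ} :
    rank N f g x = rank N f g y ↔ firstOf N f g x = firstOf N f g y := by
  have h₁ := hfg.rank_lt_iff (x := x) (y := y)
  have h₂ := hfg.rank_lt_iff (x := y) (y := x)
  omega

open Classical in
theorem EndpointOrder.exists_rank_eq (hfg : EndpointOrder N f g) {m j : ℕ}
    (hj : j < Nat.count (IsFirst N f g) m) : ∃ y < m, IsFirst N f g y ∧ rank N f g y = j := by
  have hmem := Nat.nth_mem_of_infinite (setOf_isFirst_infinite (N := N) (f := f) (g := g)) j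
  refine ⟨Nat.nth (IsFirst N f g) j, Nat.nth_lt_of_lt_count hj, hmem, ?_⟩
  rw [rank, hfg.firstOf_eq_iff.2 ⟨.refl, hmem⟩]
  exact Nat.count_nth_of_infinite setOf_isFirst_infinite j

/-- Ranks have no gaps, and the smaller ranks occur at smaller numbers. The latter keeps witnesses
within `n` bits in `spec_enumerateOrder`. -/
theorem EndpointOrder.exists_rank_eq_of_lt (hfg : EndpointOrder N f g) {x j : ℕ}
    (hj : j < rank N f g x) : ∃ y < x, rank N f g y = j := by
  obtain ⟨y, hy, -, h⟩ := hfg.exists_rank_eq hj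
  exact ⟨y, hy.trans_le (hfg.firstOf_le x), h⟩

/-- Induction over first nodes: the preceding first node `r` has rank one less, and `y`, being
unmatched, has a strictly larger depth than `r`. -/
theorem EndpointOrder.rank_le_depth (hfg : EndpointOrder N f g) {y : ℕ} (hy : y < N)
    (h : IsFirst N f g y) : rank N f g y ≤ y - g y := by
  induction y using Nat.strong_induction_on with
  | _ y ih =>
    rcases Nat.eq_zero_or_pos (rank N f g y) with h0 | hpos
    · omega
    · obtain ⟨r, hr, hrf, hrank⟩ := hfg.exists_rank_eq (m := firstOf N f g y)
        (show rank N f g y - 1 < rank N f g y by omega)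
      replace hr := hr.trans_le (hfg.firstOf_le y)
      have h₁ := ih r hr (by omega) hrf
      have h₂ : ¬y - g y ≤ r - g r := fun hle => by
        obtain ⟨x, hx⟩ := hfg.exists_matched hy hr hle
        exact h x hx
      omega

end Matching

/-! ### Specifications of the subroutines -/

section Routines

variable {n : ℕ}

theorem spec_complementEdges {χE χV : BF n} {E : ℕ → ℕ → Prop} {V : ℕ → Prop}
    (hE : Spec χE fun e => E (e .x) (e .y)) (hV : Spec χV fun e => V (e .x)) :
    Spec (complementEdges χE χV).result fun e =>
      V (e .x) ∧ V (e .y) ∧ ¬E (e .x) (e .y) ∧ e .x ≠ e .y := by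
  simp only [complementEdges, Prog.result_bind]
  exact (spec_pAnd (spec_pAnd (spec_pAnd hV (spec_pReorder _ hV)) (spec_pNot hE))
    (spec_pNot spec_xEqY)).congr fun e _ => by simp [and_assoc]

theorem spec_rightEndpoints {f : BF n} {E : ℕ → ℕ → Prop} (hf : Spec f fun e => E (e .x) (e .y)) :
    Spec (rightEndpoints f).result fun e => e .x ≤ e .y ∧ ∃ z < 2 ^ n,
      (((e .x ≤ z ∧ z < e .y) ∧ E z (e .y)) ∧ z = e .x + e .l) ∧
        ¬∃ z' < 2 ^ n, ((e .x ≤ z' ∧ z' < e .y) ∧ E z' (e .y)) ∧ z < z' := by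
  simp only [rightEndpoints, Prog.result_bind]
  have h₁ := spec_pAnd (spec_pAnd (spec_pLe (n := n) (u := .x) (v := .z) (by decide))
    (spec_pLt (n := n) (u := .z) (v := .y) (by decide))) (spec_pReorder (args .z .y) hf)
  have h₂ : Spec (pEq [.z] [.x, .l] 0 : Prog n (BF n) (BF n)).result
      fun e => e .z = e .x + e .l :=
    (spec_pEq _ _ _).congr fun e _ => by simp [weights, Vec.sum_univ]; omega
  exact (spec_pAnd (spec_pLe (by decide)) (spec_pExists .z (spec_pAnd (spec_pAnd h₁ h₂)
    (spec_pNot (spec_pExists .z' (spec_pAnd (spec_pReorder (Equiv.swap .z .z') h₁)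
      (spec_pLt (by decide)))))))).congr fun e _ => by
    simp [args, Equiv.swap_apply_def]

theorem spec_leftEndpoints {f : BF n} {E : ℕ → ℕ → Prop} (hf : Spec f fun e => E (e .x) (e .y)) :
    Spec (leftEndpoints f).result fun e => e .x ≤ e .y ∧ ∃ z < 2 ^ n,
      (((e .x < z ∧ z ≤ e .y) ∧ E (e .x) z) ∧ e .y = z + e .l) ∧
        ¬∃ z' < 2 ^ n, ((e .x < z' ∧ z' ≤ e .y) ∧ E (e .x) z') ∧ z' < z := by
  simp only [leftEndpoints, Prog.result_bind]
  have h₁ := spec_pAnd (spec_pAnd (spec_pLt (n := n) (u := .x) (v := .z) (by decide))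
    (spec_pLe (n := n) (u := .z) (v := .y) (by decide))) (spec_pReorder (args .x .z) hf)
  have h₂ : Spec (pEq [.y] [.z, .l] 0 : Prog n (BF n) (BF n)).result
      fun e => e .y = e .z + e .l :=
    (spec_pEq _ _ _).congr fun e _ => by simp [weights, Vec.sum_univ]; omega
  exact (spec_pAnd (spec_pLe (by decide)) (spec_pExists .z (spec_pAnd (spec_pAnd h₁ h₂)
    (spec_pNot (spec_pExists .z' (spec_pAnd (spec_pReorder (Equiv.swap .z .z') h₁)
      (spec_pLt (by decide)))))))).congr fun e _ => by
    simp [args, Equiv.swap_apply_def]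

theorem spec_related {f g : BF n} {R L : ℕ → ℕ → ℕ → Prop}
    (hf : Spec f fun e => R (e .x) (e .y) (e .l)) (hg : Spec g fun e => L (e .x) (e .y) (e .l)) :
    Spec (related f g).result fun e => ∃ l < 2 ^ n, (R (e .x) (e .y) l ∧ L (e .x) (e .y) l) ∧
      ¬∃ l' < 2 ^ n, ∃ z < 2 ^ n, z < e .y ∧ R (e .x) z l' ∧ L (e .x) z l' := by
  simp only [related, Prog.result_bind]
  exact (spec_pExists .l (spec_pAnd (spec_pAnd hf hg) (spec_pNot (spec_pExists .l'
    (spec_pExists .z (spec_pAnd (spec_pLt (by decide)) (spec_pAnd (spec_pReorder _ hf)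
      (spec_pReorder _ hg)))))))).congr fun e _ => by
    simp [args, Equiv.swap_apply_def]

theorem spec_firstElements {f : BF n} {S : ℕ → ℕ → Prop} (hf : Spec f fun e => S (e .x) (e .y)) :
    Spec (firstElements f).result fun e => ¬∃ w < 2 ^ n, S w (e .x) ∧ w < e .x := by
  simp only [firstElements, Prog.result_bind]
  exact (spec_pNot (spec_pExists .x' (spec_pAnd (spec_pReorder _ hf)
    (spec_pLt (by decide))))).congr fun e _ => by
    simp [args, Equiv.swap_apply_def]

theorem spec_colorOrder {f g : BF n} {S : ℕ → ℕ → Prop} {F : ℕ → Prop}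
    (hf : Spec f fun e => S (e .x) (e .y)) (hg : Spec g fun e => F (e .x)) :
    Spec (colorOrder f g).result fun e => ∃ v < 2 ^ n, ∃ u < 2 ^ n,
      ((S u (e .x) ∧ F u) ∧ S v (e .y) ∧ F v) ∧ u < v := by
  simp only [colorOrder, Prog.result_bind]
  exact (spec_pExists .y' (spec_pExists .x' (spec_pAnd (spec_pAnd
    (spec_pAnd (spec_pReorder _ hf) (spec_pReorder _ hg))
    (spec_pAnd (spec_pReorder _ hf) (spec_pReorder _ hg))) (spec_pLt (by decide))))).congr
    fun e _ => by simp [args, Equiv.swap_apply_def]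

/-- `y` is reached from `x` by `k` steps of `r`. -/
def Steps (r : ℕ → ℕ → Prop) : ℕ → ℕ → ℕ → Prop
  | 0, x, y => x = y
  | k + 1, x, y => ∃ z, Steps r k x z ∧ r z y

theorem steps_add {r : ℕ → ℕ → Prop} {j k x y : ℕ} :
    Steps r (j + k) x y ↔ ∃ z, Steps r j x z ∧ Steps r k z y := by
  induction k generalizing y with
  | zero => simp [Steps]
  | succ k ih =>
    change (∃ w, Steps r (j + k) x w ∧ r w y) ↔ ∃ z, Steps r j x z ∧ ∃ w, Steps r k z w ∧ r w y
    simp only [ih]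
    exact ⟨fun ⟨w, ⟨z, h₁, h₂⟩, h₃⟩ => ⟨z, h₁, w, h₂, h₃⟩,
      fun ⟨z, h₁, w, h₂, h₃⟩ => ⟨w, ⟨z, h₁, h₂⟩, h₃⟩⟩

theorem steps_refl {r : ℕ → ℕ → Prop} {x : ℕ} (hx : r x x) (k : ℕ) : Steps r k x x := by
  induction k with
  | zero => rfl
  | succ k ih => exact ⟨x, ih, hx⟩

theorem Steps.le {r : ℕ → ℕ → Prop} (hr : ∀ x y, r x y → x ≤ y) {k x y : ℕ}
    (h : Steps r k x y) : x ≤ y := by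
  induction k generalizing y with
  | zero => exact Nat.le_of_eq h
  | succ k ih => obtain ⟨z, h₁, h₂⟩ := h; exact (ih h₁).trans (hr _ _ h₂)

-- Equality allows idle steps, and a strictly increasing chain ending in `y` has at most `y` proper
-- ones.
open Relation in
theorem steps_or_eq_iff {r : ℕ → ℕ → Prop} (hr : ∀ x y, r x y → x < y) {k x y : ℕ} (hy : y ≤ k) :
    Steps (fun x y => r x y ∨ x = y) k x y ↔ ReflTransGen r x y := by
  constructor
  · clear hy
    intro h
    induction k generalizing y with
    | zero => exact h ▸ .refl
    | succ k ih =>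
      obtain ⟨z, h₁, h₂ | rfl⟩ := h
      · exact (ih h₁).tail h₂
      · exact ih h₁
  · intro h
    induction k generalizing y with
    | zero =>
      rcases h.cases_tail with h | ⟨z, -, h⟩
      · exact h.symm
      · exact absurd (hr _ _ h) (by omega)
    | succ k ih =>
      rcases h.cases_tail with h | ⟨z, hz, h⟩
      · exact h ▸ steps_refl (.inr rfl) _
      · exact ⟨z, ih (by have := hr _ _ h; omega) hz, .inl h⟩

open Relation in
theorem spec_transitiveClosure {f : BF n} {r : ℕ → ℕ → Prop} (hr : ∀ x y, r x y → x < y)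
    (hf : Spec f fun e => r (e .x) (e .y) ∨ e .x = e .y) :
    Spec (transitiveClosure f).result fun e => ReflTransGen r (e .x) (e .y) := by
  rw [transitiveClosure, Prog.result_foldlM]
  suffices h : ∀ m, Spec ((List.range m).foldl _ f) fun e =>
      Steps (fun x y => r x y ∨ x = y) (2 ^ m) (e .x) (e .y) from
    (h (n + 1)).congr fun e he =>
      steps_or_eq_iff hr ((he .y).le.trans (Nat.pow_le_pow_right two_pos n.le_succ))
  intro m
  induction m with
  | zero => exact hf.congr fun e _ => by simp [Steps]
  | succ m ih =>
    rw [List.range_succ, List.foldl_append, List.foldl_cons, List.foldl_nil]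
    simp only [Prog.result_bind]
    refine (spec_pExists .z (spec_pAnd (spec_pReorder (args .x .z) ih)
      (spec_pReorder (args .z .y) ih))).congr fun e he => ?_
    simp only [args, Equiv.swap_apply_def, pow_succ, mul_two, steps_add]
    simp only [Equiv.Perm.mul_apply, Equiv.swap_apply_def, reduceCtorEq, if_true, if_false,
      Function.update_apply]
    refine exists_congr fun z => ⟨fun h => h.2, fun h => ⟨?_, h⟩⟩
    -- The midpoint fits into `n` bits: steps never decrease, so it is at most `e .y`.
    exact (h.2.le fun x y hxy => hxy.elim (fun h => (hr _ _ h).le) Eq.le).trans_lt (he .y)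

theorem spec_enumStart {f : BF n} {D : ℕ → ℕ → Prop} (hf : Spec f fun e => D (e .x) (e .y)) :
    Spec (enumStart f).result fun e => (e .l = 0 ∧ e .x = e .y) ∨ (e .l = 1 ∧ D (e .x) (e .y)) := by
  simp only [enumStart, Prog.result_bind]
  have h (T : ℕ) : Spec (pEq [.l] [] T : Prog n (BF n) (BF n)).result fun e => e .l = T :=
    (spec_pEq _ _ _).congr fun e _ => by simp [weights, Vec.sum_univ]; omega
  exact spec_pOr (spec_pAnd (h 0) spec_xEqY) (spec_pAnd (h 1) hf)

theorem spec_enumStep {f : BF n} {P : ℕ → ℕ → ℕ → Prop} {j : ℕ} (hj : j < n)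
    (hf : Spec f fun e => P (e .x) (e .y) (e .l)) :
    Spec (enumStep f j).result fun e => (e .l ≤ 2 ^ j ∧ P (e .x) (e .y) (e .l)) ∨
      (2 ^ j < e .l ∧ e .l ≤ 2 ^ (j + 1)) ∧ ∃ l' < 2 ^ n, ∃ z < 2 ^ n,
        (P (e .x) z (2 ^ j) ∧ P z (e .y) l') ∧ e .l = l' + 2 ^ j := by
  simp only [enumStep, Prog.result_bind]
  have h₁ (k : ℕ) : Spec (pGe [] [.l] (-2 ^ k) : Prog n (BF n) (BF n)).result
      fun e => e .l ≤ 2 ^ k :=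
    (spec_pGe _ _ _).congr fun e _ => by
      simp [weights, Vec.sum_univ]; exact_mod_cast Iff.rfl
  have h₂ : Spec (pGe [.l] [] (2 ^ j + 1) : Prog n (BF n) (BF n)).result fun e => 2 ^ j < e .l :=
    (spec_pGe _ _ _).congr fun e _ => by
      simp [weights, Vec.sum_univ]; exact_mod_cast Iff.rfl
  have h₃ : Spec (pEq [.l] [.l'] (2 ^ j) : Prog n (BF n) (BF n)).result
      fun e => e .l = e .l' + 2 ^ j :=
    (spec_pEq _ _ _).congr fun e _ => by
      have : ((2 ^ j : ℕ) : ℤ) = 2 ^ j := by push_cast; rfl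
      simp [weights, Vec.sum_univ]; omega
  exact (spec_pOr (spec_pAnd (h₁ j) hf) (spec_pAnd (spec_pAnd h₂ (h₁ (j + 1)))
    (spec_pExists .l' (spec_pExists .z (spec_pAnd (spec_pAnd
      (spec_pReorder _ (spec_pConst .l (Nat.pow_lt_pow_right one_lt_two hj) hf))
      (spec_pReorder _ hf)) h₃))))).congr fun e _ => by
    simp [args, Equiv.swap_apply_def]

/-- The elements of an order by ranks are enumerated by these ranks. -/
theorem spec_enumerateOrder {f : BF n} {ρ : ℕ → ℕ}
    (hρ : ∀ x, ∀ j < ρ x, ∃ y < x, ρ y = j) (hf : Spec f fun e => ρ (e .x) < ρ (e .y)) :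
    Spec (enumerateOrder f).result fun e => e .l = ρ (e .x) := by
  simp only [enumerateOrder, Prog.result_bind, Prog.result_foldlM]
  -- Without gaps in the ranks, having nothing in between means a rank difference of exactly one.
  have hDS := (spec_pAnd hf (spec_pNot (spec_pExists .z (spec_pAnd (spec_pReorder (args .x .z) hf)
    (spec_pReorder (args .z .y) hf))))).congr (Q := fun e => ρ (e .y) = ρ (e .x) + 1)
    fun e he => by
      simp only [args, Equiv.Perm.mul_apply, Equiv.swap_apply_def, reduceCtorEq, if_true, if_false,
        Function.update_apply]
      constructor
      · rintro ⟨h₁, h₂⟩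
        by_contra h₃
        obtain ⟨z, hz, hz'⟩ := hρ (e .y) (ρ (e .x) + 1) (by omega)
        exact h₂ ⟨z, hz.trans (he .y), by omega, by omega⟩
      · intro h
        exact ⟨by omega, fun ⟨z, _, h₁, h₂⟩ => by omega⟩
  -- The clause `e .l = 0` is separate because it demands equal elements, not merely equal ranks.
  have hEO : ∀ D : BF n, (Spec D fun e => ρ (e .y) = ρ (e .x) + 1) → ∀ m ≤ n, Spec ((List.range m).foldl
      (fun t i => (enumStep t i : Prog n (BF n) (BF n)).result) (enumStart D).result)
      fun e => (e .l = 0 ∧ e .x = e .y) ∨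
        ((0 < e .l ∧ e .l ≤ 2 ^ m) ∧ ρ (e .y) = ρ (e .x) + e .l) := by
    intro D hD m hm
    induction m with
    | zero =>
      refine (spec_enumStart (D := fun x y => ρ y = ρ x + 1) hD).congr fun e _ => ?_
      refine or_congr_right ?_
      constructor
      · rintro ⟨h₁, h₂⟩; exact ⟨by simp [h₁], by omega⟩
      · rintro ⟨⟨h₁, h₂⟩, h₃⟩
        rw [pow_zero] at h₂
        exact ⟨by omega, by omega⟩
    | succ m ih =>
      rw [List.range_succ, List.foldl_append, List.foldl_cons, List.foldl_nil]
      refine (spec_enumStep (P := fun x y l => (l = 0 ∧ x = y) ∨ ((0 < l ∧ l ≤ 2 ^ m) ∧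
        ρ y = ρ x + l)) (by omega) (ih (by omega))).congr fun e he => ?_
      have hpos : 0 < 2 ^ m := Nat.two_pow_pos m
      have hpow : 2 ^ (m + 1) = 2 ^ m + 2 ^ m := by rw [pow_succ, mul_two]
      rw [hpow]
      constructor
      · rintro (⟨h₁, h₂⟩ | ⟨⟨h₁, h₂⟩, l', hl', z, hz, ⟨h₃, h₄⟩, h₅⟩)
        · omega
        · rcases h₄ with ⟨h₄, rfl⟩ | h₄ <;> omega
      · rintro (h | ⟨⟨h₁, h₂⟩, h₃⟩)
        · exact .inl ⟨by omega, .inl h⟩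
        · by_cases h : e .l ≤ 2 ^ m
          · exact .inl ⟨h, .inr ⟨⟨h₁, h⟩, h₃⟩⟩
          · obtain ⟨z, hz, hz'⟩ := hρ (e .y) (ρ (e .x) + 2 ^ m) (by omega)
            have := he .l
            exact .inr ⟨⟨by omega, h₂⟩, e .l - 2 ^ m, by omega, z, hz.trans (he .y),
              ⟨.inr ⟨⟨hpos, le_rfl⟩, hz'⟩, .inr ⟨⟨by omega, by omega⟩, by omega⟩⟩, by omega⟩
  refine (spec_pExists .z (spec_pAnd (spec_pReorder (args .z .x) (hEO _ hDS n le_rfl)) (spec_pNot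
    (spec_pExists .z' (spec_pReorder (args .z' .z) hf))))).congr fun e he => ?_
  simp only [args, Equiv.Perm.mul_apply, Equiv.swap_apply_def, reduceCtorEq, if_true, if_false,
    Function.update_apply]
  have hzero : ∀ z < 2 ^ n, (¬∃ m < 2 ^ n, ρ m < ρ z) ↔ ρ z = 0 := fun z hz => by
    constructor
    · intro h
      by_contra h0
      obtain ⟨y, hy, hy'⟩ := hρ z 0 (by omega)
      exact h ⟨y, hy.trans hz, by omega⟩
    · rintro h ⟨m, -, hm⟩
      omega
  constructor
  · rintro ⟨z, hz, h₁, h₂⟩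
    rw [hzero z hz] at h₂
    rcases h₁ with ⟨h₁, rfl⟩ | h₁ <;> omega
  · intro h
    -- At rank `0` the starting element must be `e .x` itself, by the clause for `l = 0`.
    rcases Nat.eq_zero_or_pos (ρ (e .x)) with h0 | hpos
    · exact ⟨e .x, he .x, .inl ⟨by omega, rfl⟩, (hzero _ (he .x)).2 h0⟩
    · obtain ⟨z, hz, hz'⟩ := hρ (e .x) 0 hpos
      exact ⟨z, hz.trans (he .x), .inr ⟨⟨by omega, (he .l).le⟩, by omega⟩,
        (hzero z (hz.trans (he .x))).2 hz'⟩

end Routines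

/-! ### Correctness and optimality of the coloring -/

section Coloring

variable {n N : ℕ} {f g : ℕ → ℕ} {C : ℕ → ℕ → Prop}

/-- The largest non-neighbor to the left of `y` is `g y - 1`, so `l = g y - 1 - x`. The relation `C`
is only consulted above the diagonal. -/
theorem EndpointOrder.spec_rightEndpoints (hfg : EndpointOrder N f g) (hN : N ≤ 2 ^ n) {F : BF n}
    (hC : ∀ x y, x < y → (C x y ↔ y < N ∧ x < g y)) (hF : Spec F fun e => C (e .x) (e .y)) :
    Spec (rightEndpoints F).result fun e => e .y < N ∧ g (e .y) = e .x + e .l + 1 := by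
  refine (ImplicitColoring.spec_rightEndpoints hF).congr fun e he => ?_
  constructor
  · rintro ⟨-, z, hz, ⟨⟨⟨h₁, h₂⟩, h₃⟩, h₄⟩, h₅⟩
    rw [hC _ _ h₂] at h₃
    refine ⟨h₃.1, ?_⟩
    by_contra h
    have := hfg.count_le _ h₃.1
    exact h₅ ⟨z + 1, by omega, ⟨⟨by omega, by omega⟩, (hC _ _ (by omega)).2 ⟨h₃.1, by omega⟩⟩,
      by omega⟩
  · rintro ⟨h₁, h₂⟩
    have := hfg.count_le _ h₁
    refine ⟨by omega, e .x + e .l, by omega, ⟨⟨⟨by omega, by omega⟩,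
      (hC _ _ (by omega)).2 ⟨h₁, by omega⟩⟩, rfl⟩, ?_⟩
    rintro ⟨z, -, ⟨⟨-, h₃⟩, h₄⟩, h₅⟩
    have := ((hC _ _ h₃).1 h₄).2
    omega

/-- The smallest non-neighbor to the right of `x` is `f x`, so `l = y - f x`. -/
theorem EndpointOrder.spec_leftEndpoints (hfg : EndpointOrder N f g) (hN : N ≤ 2 ^ n) {F : BF n}
    (hC : ∀ x y, x < y → (C x y ↔ y < N ∧ x < g y)) (hF : Spec F fun e => C (e .x) (e .y)) :
    Spec (leftEndpoints F).result
      fun e => e .x < N ∧ f (e .x) < N ∧ e .y = f (e .x) + e .l := by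
  replace hC : ∀ x y, x < y → (C x y ↔ y < N ∧ f x ≤ y) := fun x y h => by
    rw [hC x y h]
    exact and_congr_right fun hy => hfg.lt_iff x y (h.trans hy) hy
  refine (ImplicitColoring.spec_leftEndpoints hF).congr fun e he => ?_
  constructor
  · rintro ⟨-, z, hz, ⟨⟨⟨h₁, h₂⟩, h₃⟩, h₄⟩, h₅⟩
    rw [hC _ _ h₁] at h₃
    have hx := hfg.lt_first (e .x) (by omega)
    refine ⟨by omega, by omega, ?_⟩
    by_contra h
    exact h₅ ⟨f (e .x), by omega, ⟨⟨hx, by omega⟩, (hC _ _ hx).2 ⟨by omega, le_rfl⟩⟩, by omega⟩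
  · rintro ⟨h₁, h₂, h₃⟩
    have hx := hfg.lt_first _ h₁
    refine ⟨by omega, f (e .x), by omega, ⟨⟨⟨hx, by omega⟩,
      (hC _ _ hx).2 ⟨by omega, le_rfl⟩⟩, h₃⟩, ?_⟩
    rintro ⟨z, -, ⟨⟨h₄, -⟩, h₅⟩, h₆⟩
    have := ((hC _ _ h₄).1 h₅).2
    omega

theorem EndpointOrder.spec_related (hfg : EndpointOrder N f g) (hN : N ≤ 2 ^ n) {F : BF n}
    (hC : ∀ x y, x < y → (C x y ↔ y < N ∧ x < g y)) (hF : Spec F fun e => C (e .x) (e .y)) :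
    Spec (related (rightEndpoints F).result (leftEndpoints F).result).result
      fun e => Matched N f g (e .x) (e .y) := by
  refine (ImplicitColoring.spec_related
    (R := fun x y l => y < N ∧ g y = x + l + 1) (L := fun x y l => x < N ∧ f x < N ∧ y = f x + l)
    (hfg.spec_rightEndpoints hN hC hF) (hfg.spec_leftEndpoints hN hC hF)).congr fun e he => ?_
  constructor
  · rintro ⟨l, hl, ⟨⟨h₁, h₂⟩, h₃, h₄, h₅⟩, h⟩
    refine ⟨⟨h₃, h₁, by omega, by omega⟩, fun z hz ⟨h₆, h₇, h₈, h₉⟩ => h ?_⟩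
    exact ⟨z - f (e .x), by omega, z, by omega, hz, ⟨h₇, by omega⟩, h₆, h₄, by omega⟩
  · rintro ⟨⟨h₁, h₂, h₃, h₄⟩, h⟩
    refine ⟨e .y - f (e .x), by omega, ⟨⟨h₂, by omega⟩, h₁, by omega, by omega⟩, ?_⟩
    rintro ⟨l, -, z, -, hz, ⟨h₅, h₆⟩, -, -, h₇⟩
    exact h z hz ⟨h₁, h₅, by omega, by omega⟩

theorem EndpointOrder.spec_unitColoring (hfg : EndpointOrder N f g) (hN : N ≤ 2 ^ n)
    {χE χV : BF n} (hC : ∀ x y, x < y → (C x y ↔ y < N ∧ x < g y))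
    (hF : Spec (complementEdges χE χV).result fun e => C (e .x) (e .y)) :
    Spec (unitColoring χE χV).result fun e => e .l = rank N f g (e .x) := by
  simp only [unitColoring, Prog.result_bind]
  have hSC := spec_transitiveClosure (r := Matched N f g) (fun x y h => h.lt hfg)
    (spec_pOr (hfg.spec_related hN hC hF) spec_xEqY)
  have hFirst := (spec_firstElements hSC).congr (Q := fun e => IsFirst N f g (e .x))
    fun e he => by
      rw [hfg.isFirst_iff]
      exact not_congr ⟨fun ⟨w, _, h⟩ => ⟨w, h⟩, fun ⟨w, h⟩ => ⟨w, h.2.trans (he .x), h⟩⟩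
  refine spec_enumerateOrder (fun x j => hfg.exists_rank_eq_of_lt)
    ((spec_colorOrder (F := IsFirst N f g) hSC hFirst).congr fun e he => ?_)
  simp only [hfg.rank_lt_iff, ← hfg.firstOf_eq_iff]
  constructor
  · rintro ⟨v, -, u, -, ⟨rfl, rfl⟩, h⟩
    exact h
  · exact fun h => ⟨_, (hfg.firstOf_le _).trans_lt (he .y), _, (hfg.firstOf_le _).trans_lt (he .x),
      ⟨rfl, rfl⟩, h⟩

/-- The nonadjacent pairs of nodes of a unit interval graph are described by the orders of the
endpoints of the intervals. -/
theorem IsUnitIntervalGraph.exists_endpointOrder {G : SimpleGraph (Fin N)}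
    (hG : IsUnitIntervalGraph G) : ∃ f g, EndpointOrder N f g ∧
      ∀ i j : Fin N, i < j → (¬G.Adj i j ↔ (i : ℕ) < g j) := by
  obtain ⟨a, ha, hadj⟩ := hG
  -- Interval `x` ends before interval `y` starts. This is inherited by smaller `x` and larger `y`,
  -- so thresholds `f` and `g` describe it.
  let E : ℕ → ℕ → Prop := fun x y => ∃ i j : Fin N, (i : ℕ) = x ∧ (j : ℕ) = y ∧ a i + 1 < a j
  have hElt : ∀ {x y}, E x y → x < y ∧ y < N := by
    rintro _ _ ⟨i, j, rfl, rfl, h⟩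
    refine ⟨?_, j.2⟩
    by_contra hle
    have := ha (Fin.le_def.2 (not_lt.1 hle))
    linarith
  have hEmono : ∀ {x x' y y'}, E x y → x' ≤ x → y ≤ y' → y' < N → E x' y' := by
    rintro _ x' _ y' ⟨i, j, rfl, rfl, h⟩ hx hy hN
    have h₁ := ha (show (⟨x', by omega⟩ : Fin N) ≤ i from hx)
    have h₂ := ha (show j ≤ (⟨y', hN⟩ : Fin N) from hy)
    exact ⟨⟨x', by omega⟩, ⟨y', hN⟩, rfl, rfl, by linarith⟩
  have hf : ∀ x, sInf {z | z = N ∨ E x z} = N ∨ E x (sInf {z | z = N ∨ E x z}) := fun x =>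
    Nat.sInf_mem (s := {z | z = N ∨ E x z}) ⟨N, .inl rfl⟩
  have hg : ∀ y, ¬E (sInf {z | ¬E z y}) y := fun y =>
    Nat.sInf_mem (s := {z | ¬E z y}) ⟨y, fun h => lt_irrefl _ (hElt h).1⟩
  have hgE : ∀ {x y}, x < sInf {z | ¬E z y} ↔ E x y := fun {x y} =>
    ⟨fun h => not_not.1 (Nat.notMem_of_lt_sInf h), fun h => by
      by_contra hle
      exact hg y (hEmono h (not_lt.1 hle) le_rfl (hElt h).2)⟩
  refine ⟨fun x => sInf {z | z = N ∨ E x z}, fun y => sInf {z | ¬E z y}, ⟨?_, ?_, ?_, ?_⟩, ?_⟩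
  · intro x hx
    rcases hf x with h | h
    · exact hx.trans_eq h.symm
    · exact (hElt h).1
  · exact fun y _ => Nat.sInf_le fun h => lt_irrefl _ (hElt h).1
  · intro x y _ hy
    refine hgE.trans ⟨fun h => Nat.sInf_le (.inr h), fun h => ?_⟩
    rcases hf x with h' | h'
    · exact absurd (h'.symm.le.trans h) (not_le.2 hy)
    · exact hEmono h' le_rfl h hy
  · exact fun y y' hy hN => Nat.sInf_le fun h => hg y' (hEmono h le_rfl hy hN)
  · intro i j hij
    refine Iff.trans ?_ hgE.symm
    have hle := ha hij.le
    rw [hadj, Set.Icc_inter_Icc, Set.nonempty_Icc, not_and, not_le, sup_eq_right.2 hle,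
      inf_eq_left.2 (by linarith)]
    constructor
    · exact fun h => ⟨i, j, rfl, rfl, h hij.ne⟩
    · rintro ⟨i', j', hi, hj, h⟩ -
      obtain rfl := Fin.ext hi
      obtain rfl := Fin.ext hj
      exact h

theorem le_two_pow_bits : N ≤ 2 ^ bits N := Nat.le_pow_clog one_lt_two N

theorem spec_coloringRun {G : SimpleGraph (Fin N)} (hfg : EndpointOrder N f g)
    (hG : ∀ i j : Fin N, i < j → (¬G.Adj i j ↔ (i : ℕ) < g j)) :
    Spec (coloringRun G).result fun e => e .l = rank N f g (e .x) := by
  have hE : Spec (chiE G) fun e => ∃ i j : Fin N, e .x = i ∧ e .y = j ∧ G.Adj i j := fun a => by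
    simp only [chiE, decide_eq_true_eq]
  have hV : Spec (chiV N) fun e => e .x < N := fun a => decide_eq_true_iff
  refine hfg.spec_unitColoring le_two_pow_bits (C := fun x y => x < N ∧ y < N ∧
    ¬(∃ i j : Fin N, x = i ∧ y = j ∧ G.Adj i j) ∧ x ≠ y) ?_ (spec_complementEdges
    (E := fun x y => ∃ i j : Fin N, x = i ∧ y = j ∧ G.Adj i j) (V := (· < N)) hE hV)
  intro x y hxy
  constructor
  · rintro ⟨hx, hy, h, -⟩
    exact ⟨hy, (hG ⟨x, hx⟩ ⟨y, hy⟩ hxy).1 fun h' => h ⟨_, _, rfl, rfl, h'⟩⟩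
  · rintro ⟨hy, h⟩
    refine ⟨hxy.trans hy, hy, ?_, hxy.ne⟩
    rintro ⟨i, j, rfl, rfl, h'⟩
    exact (hG i j hxy).2 h h'

open Classical in
theorem exists_minimum_coloring {G : SimpleGraph (Fin N)} (hfg : EndpointOrder N f g)
    (hG : ∀ i j : Fin N, i < j → (¬G.Adj i j ↔ (i : ℕ) < g j)) :
    ∃ (c : G.Coloring ℕ) (k : ℕ), (∀ v : Fin N, c v = rank N f g v) ∧
      Set.range c = Set.Iio k ∧ (k : ℕ∞) = G.chromaticNumber := by
  have hproper : ∀ i j : Fin N, i < j → G.Adj i j → rank N f g i ≠ rank N f g j := by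
    intro i j hij hadj h
    have := hfg.first_le_of_firstOf_eq hij (hfg.rank_eq_iff.1 h)
    exact (hG i j hij).2 ((hfg.lt_iff i j i.2 j.2).2 this) hadj
  let c : G.Coloring ℕ := SimpleGraph.Coloring.mk (fun v => rank N f g v) fun {i j} hadj => by
    rcases lt_or_gt_of_ne hadj.ne with h | h
    · exact hproper i j h hadj
    · exact (hproper j i h hadj.symm).symm
  have hlt : ∀ v, c v < Nat.count (IsFirst N f g) N := fun v =>
    Nat.count_strict_mono (hfg.firstOf_spec v).2 ((hfg.firstOf_le v).trans_lt v.2)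
  refine ⟨c, Nat.count (IsFirst N f g) N, fun v => rfl, ?_, le_antisymm ?_ ?_⟩
  · ext j
    constructor
    · rintro ⟨v, rfl⟩
      exact hlt v
    · intro hj
      obtain ⟨y, hy, -, h⟩ := hfg.exists_rank_eq hj
      exact ⟨⟨y, hy⟩, h⟩
  · rcases Nat.eq_zero_or_pos (Nat.count (IsFirst N f g) N) with h0 | hpos
    · simp [h0]
    · obtain ⟨y, hy, hyf, hrank⟩ := hfg.exists_rank_eq
        (show Nat.count (IsFirst N f g) N - 1 < Nat.count (IsFirst N f g) N by omega)
      have hle := hfg.count_le y hy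
      have hdepth := hfg.rank_le_depth hy hyf
      have hclique : G.IsClique (Finset.Icc (⟨g y, hle.trans_lt hy⟩ : Fin N)
          ⟨y, hy⟩) := by
        have key : ∀ i j : Fin N, g y ≤ i → (j : ℕ) ≤ y → i < j → G.Adj i j := by
          intro i j hi hj hij
          by_contra h
          have h₁ := (hG i j hij).1 h
          have h₂ := hfg.mono j y hj hy
          omega
        intro i hi j hj hne
        simp only [Finset.coe_Icc, Set.mem_Icc, Fin.le_def] at hi hj
        rcases lt_or_gt_of_ne hne with h | h
        · exact key i j hi.1 hj.2 h
        · exact (key j i hj.1 hi.2 h).symm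
      refine le_trans ?_ hclique.card_le_chromaticNumber
      rw [Fin.card_Icc]
      exact Nat.cast_le.2 (show Nat.count (IsFirst N f g) N ≤ y + 1 - g y by omega)
  · have hcol : G.Colorable (Nat.count (IsFirst N f g) N) :=
      ⟨SimpleGraph.Coloring.mk (fun v => ⟨c v, hlt v⟩) fun hadj h =>
        c.valid hadj (Fin.mk.inj_iff.1 h)⟩
    exact hcol.chromaticNumber_le

end Coloring

/-! ### Number of functional operations -/

section Cost

variable {n : ℕ}

theorem ops_pNot (f : BF n) : (pNot f).ops = 1 := rfl
theorem ops_pAnd (f g : BF n) : (pAnd f g).ops = 1 := rfl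
theorem ops_pOr (f g : BF n) : (pOr f g).ops = 1 := rfl
theorem ops_pReorder (ρ : Equiv.Perm Vec) (f : BF n) : (pReorder ρ f).ops = 21 * n := rfl
theorem ops_pEq (p q : List Vec) (T : ℤ) : (pEq p q T : Prog n (BF n) (BF n)).ops = 3 := rfl
theorem ops_pGe (p q : List Vec) (T : ℤ) : (pGe p q T : Prog n (BF n) (BF n)).ops = 1 := rfl
theorem ops_pLe (u v : Vec) : (pLe u v : Prog n (BF n) (BF n)).ops = 1 := rfl
theorem ops_pLt (u v : Vec) : (pLt u v : Prog n (BF n) (BF n)).ops = 1 := rfl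

theorem ops_pExists (v : Vec) (f : BF n) : (pExists v f).ops = n := by
  rw [pExists, Prog.ops_foldlM _ _ _ (k := 1) fun _ _ => rfl, List.length_finRange, mul_one]

theorem ops_pConst (v : Vec) (m : ℕ) (f : BF n) : (pConst v m f).ops = n := by
  rw [pConst, Prog.ops_foldlM _ _ _ (k := 1) fun _ _ => rfl, List.length_finRange, mul_one]

theorem ops_transitiveClosure (f : BF n) :
    (transitiveClosure f).ops = (n + 1) * (43 * n + 1) := by
  rw [transitiveClosure, Prog.ops_foldlM (k := 43 * n + 1), List.length_range]
  intro t _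
  simp only [Prog.ops_bind, ops_pAnd, ops_pReorder, ops_pExists]
  ring

theorem ops_enumStep (f : BF n) (j : ℕ) : (enumStep f j).ops = 45 * n + 12 := by
  simp only [enumStep, Prog.ops_bind, ops_pAnd, ops_pOr, ops_pGe, ops_pEq, ops_pReorder,
    ops_pExists, ops_pConst]
  ring

/-- The quadratic part comes from the `n + 1` squarings (`43 n` each) and the `n` doubling rounds
(`45 n` each). -/
theorem ops_unitColoring (χE χV : BF n) :
    (unitColoring χE χV).ops = 88 * n ^ 2 + 405 * n + 72 := by
  simp only [unitColoring, complementEdges, rightEndpoints, leftEndpoints, related,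
    firstElements, colorOrder, enumerateOrder, enumStart, Prog.ops_bind, ops_pAnd, ops_pOr,
    ops_pNot, ops_pEq, ops_pLe, ops_pLt, ops_pReorder, ops_pExists,
    ops_transitiveClosure, Prog.ops_foldlM _ _ _ ops_enumStep, List.length_range]
  ring

theorem ops_coloringRun_le {N : ℕ} (G : SimpleGraph (Fin N)) (hN : 2 ≤ N) :
    ((coloringRun G).ops : ℝ) ≤ 1234 * Real.logb 2 N ^ 2 := by
  have hlog : 1 ≤ Real.logb 2 N := by
    rw [Real.le_logb_iff_rpow_le one_lt_two (by positivity)]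
    exact_mod_cast hN
  -- Rounding up adds less than `1`, which is at most the logarithm since `N ≥ 2`.
  have hbits : (bits N : ℝ) ≤ 2 * Real.logb 2 N := by
    have h := Nat.ceil_lt_add_one (zero_le_one.trans hlog)
    rw [← Nat.cast_ofNat, Real.natCeil_logb_natCast, Nat.cast_ofNat] at h
    linarith
  rw [coloringRun, ops_unitColoring]
  push_cast
  -- `1234 = 88 * 4 + 405 * 2 + 72`.
  nlinarith [Nat.cast_nonneg (α := ℝ) (bits N)]

end Cost

end ImplicitColoring

theorem mainTheorem6 :
    (∀ (N : ℕ) (G : SimpleGraph (Fin N)), ImplicitColoring.IsUnitIntervalGraph G →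
      ∃ (c : G.Coloring ℕ) (k : ℕ),
        (∀ (v : Fin N) (a : ImplicitColoring.Assignment (ImplicitColoring.bits N)),
          ImplicitColoring.val (a .x) = v →
            ((ImplicitColoring.coloringRun G).result a = true ↔
              ImplicitColoring.val (a .l) = c v)) ∧
        Set.range c = Set.Iio k ∧
        (k : ℕ∞) = G.chromaticNumber) ∧
    (∃ C : ℝ, ∀ (N : ℕ) (G : SimpleGraph (Fin N)), 2 ≤ N →
      ImplicitColoring.IsUnitIntervalGraph G →
        ((ImplicitColoring.coloringRun G).ops : ℝ) ≤ C * Real.logb 2 N ^ 2) := by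
  refine ⟨fun N G hG => ?_, 1234, fun N G hN _ => ImplicitColoring.ops_coloringRun_le G hN⟩
  obtain ⟨f, g, hfg, hadj⟩ := hG.exists_endpointOrder
  obtain ⟨c, k, hc, hk⟩ := ImplicitColoring.exists_minimum_coloring hfg hadj
  refine ⟨c, k, fun v a hv => ?_, hk⟩
  rw [hc, ← hv]
  exact ImplicitColoring.spec_coloringRun hfg hadj a
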